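/- Let $n>2$ be a prime number, $\zeta$ a primitive $n$-th root of unity, and let $\mathbf p^{(1)},\dots,\mathbf p^{(\ell)}$ be distinct elements of $\mathbb N_{-1}\times\mathbb N_0^{\,n-1}$ (where $\mathbb N_{-1}=\mathbb N_0\cup\{-1\}$) with $\sum_{j=1}^n p^{(k)}_j\ge 1$ for all $k$. Put $T_n(q_1,\dots,q_n)=(q_n,q_1,\dots,q_{n-1})$ and consider the family of systems $$\dot x_i=x_i\Bigl(\zeta^{i-1}+\sum_{k=1}^{\ell}a_{k,i}\,\mathbf x^{T_n^{i-1}(\mathbf p^{(k)})}\Bigr),\qquad i=1,\dots,n, \tag{nSYS}$$ with complex parameters $a=(a_{k,i})_{1\le k\le\ell,\,1\le i\le n}$; write it as $\dot{\mathbf x}=\mathcal Z\mathbf x+X(\mathbf x)$ with $\mathcal Z=\operatorname{diag}(1,\zeta,\dots,\zeta^{n-1})$. The second index of $a_{k,i}$ is read modulo $n$, so $a_{k,n+1}=a_{k,1}$. For $\nu\in\mathbb N_0^{n\ell}$, indexed as $\nu=(\nu_{k,i})$, let $[\nu]=\prod_{k,i}a_{k,i}^{\nu_{k,i}}$, let $\hat\nu$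 be obtained from $\nu$ by replacing each block $(\nu_{k,1},\dots,\nu_{k,n})$ by $(\nu_{k,n},\nu_{k,1},\dots,\nu_{k,n-1})$, and let $L(\nu)=\sum_{k,i}\nu_{k,i}\,T_n^{i-1}(\mathbf p^{(k)})\in\mathbb Z^n$. Let $$\mathcal M^{(n)}=\{\nu\in\mathbb N_0^{n\ell}:\ L(\nu)=(K,\dots,K)\text{ for some }K\in\mathbb N_0\},\qquad I_S^{(n)}=\langle[\nu]-[\hat\nu]:\nu\in\mathcal M^{(n)}\rangle\subset\mathbb C[a].$$ In $\mathbb C[\alpha_1^{\pm1},\dots,\alpha_n^{\pm1},a]$ let $I^{(E)}$ be the ideal generated by $1-\alpha_1\cdots\alpha_n$ and all $a_{k,i}\,\alpha^{T_n^{i-1}(\mathbf p^{(k)})}-a_{k,i+1}$, $1\le k\le\ell$, $1\le i\le n$, and put $\mathcal I_E=I^{(E)}\cap\mathbb C[a]$. Let $\mathsf a=\prod_{k,i}a_{k,i}$. Then $$I_S^{(n)}:\mathsf a^{\infty}=\mathcal I_E .$$ Moreover, the variety of $\mathcal I_E$ in $\mathbb C^{n\ell}$ is the Zariski closure of the set of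 parameters of the equivariant systems, that is, of those $a$ for which there are $\alpha_1,\dots,\alpha_n\in\mathbb C$ with $\alpha_1\cdots\alpha_n=1$ such that $A\,X(\mathbf x)=X(A\mathbf x)$ for all $\mathbf x\in\mathbb C^n$, where $A$ is the $n\times n$ matrix with entries $\alpha_1,\dots,\alpha_{n-1},\alpha_n$ at the places $(1,2),\dots,(n-1,n),(n,1)$ and zeros elsewhere. -/

import Mathlib

namespace Sibirsky

noncomputable section

/-- The cyclic permutation `T_n^m` of the components of an `n`-tuple:
`T_n (q_1, …, q_n) = (q_n, q_1, …, q_{n-1})`. Positions are counted from `0` and taken mod `n`. -/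
def cyc {n : ℕ} [NeZero n] (m : Fin n) (q : Fin n → ℤ) : Fin n → ℤ := fun j => q (j - m)

/-- The polynomial ring `ℂ[a]` in the parameters of the family. The variable with index `(k, m)`
is the coefficient `a^{(m+1)}_{T_n^m(p^{(k)})}` of the `k`-th monomial in the equation number `m+1`
(that is, number `m` when counted from `0`). -/
abbrev ParamRing (n ℓ : ℕ) := MvPolynomial (Fin ℓ × Fin n) ℂ

/-- The monomial `[ν]`. -/
def mono {n ℓ : ℕ} (ν : Fin ℓ × Fin n → ℕ) : ParamRing n ℓ :=
  ∏ km : Fin ℓ × Fin n, MvPolynomial.X km ^ ν km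

/-- `ν̂`, the cyclic shift of each block of `ν`:
`(ν_{k,1}, …, ν_{k,n}) ↦ (ν_{k,n}, ν_{k,1}, …, ν_{k,n-1})`. -/
def hat {n ℓ : ℕ} [NeZero n] (ν : Fin ℓ × Fin n → ℕ) : Fin ℓ × Fin n → ℕ :=
  fun km => ν (km.1, km.2 - 1)

/-- The `j`-th coordinate of `L(ν) = ∑_k ∑_m ν_{k,m} T_n^m(p^{(k)})`. -/
def L {n ℓ : ℕ} [NeZero n] (p : Fin ℓ → Fin n → ℤ) (ν : Fin ℓ × Fin n → ℕ) (j : Fin n) : ℤ :=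
  ∑ k : Fin ℓ, ∑ m : Fin n, cyc m (p k) j * (ν (k, m) : ℤ)

/-- The monoid `M^{(n)}` of all `ν` with `L(ν) = (K, …, K)` for some `K ∈ ℕ₀`. -/
def monoidM {n ℓ : ℕ} [NeZero n] (p : Fin ℓ → Fin n → ℤ) : Set (Fin ℓ × Fin n → ℕ) :=
  {ν | ∃ K : ℕ, ∀ j : Fin n, L p ν j = (K : ℤ)}

/-- The Sibirsky ideal `I_S^{(n)} = ⟨[ν] - [ν̂] : ν ∈ M^{(n)}⟩`. -/
def sibirskyIdeal {n ℓ : ℕ} [NeZero n] (p : Fin ℓ → Fin n → ℤ) : Ideal (ParamRing n ℓ) :=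
  Ideal.span {f | ∃ ν ∈ monoidM p, f = mono ν - mono (hat ν)}

/-- The product of all parameters. -/
def paramProd (n ℓ : ℕ) : ParamRing n ℓ := ∏ km : Fin ℓ × Fin n, MvPolynomial.X km

/-- The saturation `I : f^∞`. -/
def saturation {R : Type*} [CommRing R] (I : Ideal R) (f : R) : Ideal R where
  carrier := {g | ∃ m : ℕ, f ^ m * g ∈ I}
  zero_mem' := ⟨0, by simp⟩
  add_mem' := by
    rintro g h ⟨r, hr⟩ ⟨s, hs⟩
    refine ⟨r + s, ?_⟩
    have e : f ^ (r + s) * (g + h) = f ^ s * (f ^ r * g) + f ^ r * (f ^ s * h) := by ring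
    rw [e]
    exact I.add_mem (I.mul_mem_left _ hr) (I.mul_mem_left _ hs)
  smul_mem' := by
    rintro c g ⟨r, hr⟩
    refine ⟨r, ?_⟩
    have e : f ^ r * (c • g) = c * (f ^ r * g) := by rw [smul_eq_mul]; ring
    rw [e]
    exact I.mul_mem_left _ hr

/-- The Laurent polynomial ring `ℂ[α_1^{±1}, …, α_n^{±1}]`, as the group algebra of `ℤⁿ`. -/
abbrev LaurentRing (n : ℕ) := AddMonoidAlgebra ℂ (Fin n → ℤ)

/-- The ring `ℂ[α^±, a]`. -/
abbrev MixedRing (n ℓ : ℕ) := MvPolynomial (Fin ℓ × Fin n) (LaurentRing n)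

/-- The Laurent monomial `α^q = α_1^{q_1} ⋯ α_n^{q_n}` in `ℂ[α^±, a]`. -/
def alphaPow {n : ℕ} (ℓ : ℕ) (q : Fin n → ℤ) : MixedRing n ℓ :=
  MvPolynomial.C (AddMonoidAlgebra.single q 1)

/-- The inclusion `ℂ[a] → ℂ[α^±, a]`. -/
def inclusion (n ℓ : ℕ) : ParamRing n ℓ →+* MixedRing n ℓ :=
  MvPolynomial.map (algebraMap ℂ (LaurentRing n))

/-- The ideal `I^{(E)}` of `ℂ[α^±, a]` generated by `1 - α_1 ⋯ α_n` and the polynomials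
`a^{(i)}_{T^{i-1}(p^{(k)})} α^{T^{i-1}(p^{(k)})} - a^{(i+1)}_{T^i(p^{(k)})}`, `i` cyclic mod `n`. -/
def idealE {n ℓ : ℕ} [NeZero n] (p : Fin ℓ → Fin n → ℤ) : Ideal (MixedRing n ℓ) :=
  Ideal.span
    ({1 - alphaPow ℓ (fun _ => 1)} ∪
      {f | ∃ (k : Fin ℓ) (i : Fin n),
        f = MvPolynomial.X (k, i) * alphaPow ℓ (cyc i (p k)) - MvPolynomial.X (k, i + 1)})

/-- The elimination ideal `𝓘_E = I^{(E)} ∩ ℂ[a]`. -/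
def eliminationE {n ℓ : ℕ} [NeZero n] (p : Fin ℓ → Fin n → ℤ) : Ideal (ParamRing n ℓ) :=
  (idealE p).comap (inclusion n ℓ)

/-- The nonlinear part `X(x)` of the system with parameters `a`, whose `i`-th component is
`x_i ∑_k a_{k,i} x^{T^i(p^{(k)})}`. For the exponents of the family, where only the `i`-th entry of
`T^i(p^{(k)})` may be `-1`, the exponents below are nonnegative before `toNat` is applied. -/
def nonlinearPart {n ℓ : ℕ} [NeZero n] (p : Fin ℓ → Fin n → ℤ) (a : Fin ℓ × Fin n → ℂ)
    (x : Fin n → ℂ) : Fin n → ℂ :=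
  fun i => ∑ k : Fin ℓ, a (k, i) *
    ∏ j : Fin n, x j ^ (cyc i (p k) j + if j = i then 1 else 0).toNat

/-- The matrix with entries `α_1, …, α_n` at the places `(1,2), …, (n-1,n), (n,1)` and `0`
elsewhere. -/
def cycMatrix {n : ℕ} [NeZero n] (α : Fin n → ℂ) : Matrix (Fin n) (Fin n) ℂ :=
  Matrix.of fun i j => if j = i + 1 then α i else 0

/-- The parameters of the equivariant systems: `A X(x) = X(A x)` for some matrix `A` as above with
`α_1 ⋯ α_n = 1`. -/
def equivariantSet {n ℓ : ℕ} [NeZero n] (p : Fin ℓ → Fin n → ℤ) : Set (Fin ℓ × Fin n → ℂ) :=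
  {a | ∃ α : Fin n → ℂ, ∏ i, α i = 1 ∧
    ∀ x : Fin n → ℂ, (cycMatrix α).mulVec (nonlinearPart p a x) =
      nonlinearPart p a ((cycMatrix α).mulVec x)}

/-- Zariski closure in an affine space over `ℂ`. -/
def zariskiClosure {σ : Type*} (V : Set (σ → ℂ)) : Set (σ → ℂ) :=
  MvPolynomial.zeroLocus ℂ (MvPolynomial.vanishingIdeal ℂ V)

end

end Sibirsky

namespace Sibirsky

noncomputable section

/-! Both ideals equal the ideal of polynomials vanishing on one torus of parameters. Equivariance
amounts to `a (k, i + 1) = a (k, i) * α ^ cyc i (p k)` with `∏ α = 1` (`mem_equivariantSet_iff`).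
Solving this recursion from free nonzero values at `i = 0` gives `torusPoint`, a torus inside the
equivariant set. Both ideals vanish there; the saturation does because no parameter is zero on the
torus.

Conversely, monomials restrict to characters of the torus. By Dedekind's independence of characters,
a polynomial vanishing on it lies in every ideal containing all differences of monomials with the
same character (`mem_of_vanishing`). `sub_mem_eliminationE` and `sub_mem_saturation` put these
binomials into the two ideals. The vanishing ideal of the equivariant set is squeezed in between,
which gives the claim on closures. -/

/-- The value `∏ j, α j ^ q j` of the Laurent monomial with exponent `q`. -/
def zpowProd {G : Type*} [CommGroup G] {n : ℕ} (α : Fin n → G) :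
    Multiplicative (Fin n → ℤ) →* G where
  toFun q := ∏ j, α j ^ q.toAdd j
  map_one' := by simp
  map_mul' q r := by simp [zpow_add, Finset.prod_mul_distrib]

theorem zpowProd_ofAdd {G : Type*} [CommGroup G] {n : ℕ} (α : Fin n → G) (q : Fin n → ℤ) :
    zpowProd α (.ofAdd q) = ∏ j, α j ^ q j := rfl

theorem zpowProd_const {G : Type*} [CommGroup G] {n : ℕ} {α : Fin n → G} (hα : ∏ j, α j = 1)
    (c : ℤ) : zpowProd α (.ofAdd fun _ => c) = 1 := by
  rw [zpowProd_ofAdd, Finset.prod_zpow, hα, one_zpow]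

/-! ### Partial sums of cyclic shifts -/

/-- The sum of the first `m` cyclic shifts of `q`. -/
def partialShift {n : ℕ} [NeZero n] (q : Fin n → ℤ) (m : ℕ) : Fin n → ℤ :=
  ∑ t ∈ Finset.range m, cyc (Fin.ofNat n t) q

theorem partialShift_zero {n : ℕ} [NeZero n] (q : Fin n → ℤ) : partialShift q 0 = 0 := rfl

theorem partialShift_succ {n : ℕ} [NeZero n] (q : Fin n → ℤ) (m : ℕ) :
    partialShift q (m + 1) = partialShift q m + cyc (Fin.ofNat n m) q :=
  Finset.sum_range_succ _ _

theorem sum_cyc {n : ℕ} [NeZero n] (m : Fin n) (q : Fin n → ℤ) : ∑ j, cyc m q j = ∑ j, q j :=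
  Equiv.sum_comp (Equiv.subRight m) q

theorem partialShift_self {n : ℕ} [NeZero n] (q : Fin n → ℤ) :
    partialShift q n = fun _ => ∑ j, q j := by
  funext j
  rw [partialShift, Finset.sum_range, Finset.sum_apply]
  simp only [Fin.ofNat_val_eq_self, cyc]
  exact Equiv.sum_comp (Equiv.subLeft j) q

theorem val_add_one_cases {n : ℕ} [NeZero n] (i : Fin n) :
    (i + 1).val = i.val + 1 ∨ (i + 1).val = 0 ∧ i.val + 1 = n := by
  have h : (i + 1).val = (i.val + 1) % n := by
    rw [Fin.val_add, Fin.val_one', Nat.add_mod_mod]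
  rcases (Nat.succ_le_of_lt i.isLt).lt_or_eq with hlt | heq
  · left; rw [h, Nat.mod_eq_of_lt hlt]
  · right; exact ⟨by rw [h]; simp [← heq], heq⟩

/-- Only the wrap from the last index to `0` costs a constant vector, which is invisible to any `α`
with product one. -/
theorem partialShift_add_cyc {n : ℕ} [NeZero n] (q : Fin n → ℤ) (i : Fin n) :
    ∃ c : ℤ, partialShift q i.val + cyc i q = partialShift q (i + 1).val + fun _ => c := by
  have h := partialShift_succ q i.val
  rw [Fin.ofNat_val_eq_self] at h
  rcases val_add_one_cases i with h1 | ⟨h1, h2⟩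
  · exact ⟨0, by rw [← h, h1]; ext; simp⟩
  · exact ⟨∑ j, q j, by rw [← h, h1, h2, partialShift_self, partialShift_zero, zero_add]⟩

theorem cyc_add_one {n : ℕ} [NeZero n] (i j : Fin n) (q : Fin n → ℤ) :
    cyc (i + 1) q (j + 1) = cyc i q j := by
  simp [cyc]

/-! ### Equivariance in terms of coefficients -/

/-- The exponents of the `i`-th component of `nonlinearPart`. -/
def expo {n ℓ : ℕ} [NeZero n] (p : Fin ℓ → Fin n → ℤ) (k : Fin ℓ) (i j : Fin n) : ℕ :=
  (cyc i (p k) j + if j = i then 1 else 0).toNat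

theorem expo_add_one {n ℓ : ℕ} [NeZero n] (p : Fin ℓ → Fin n → ℤ) (k : Fin ℓ) (i j : Fin n) :
    expo p k (i + 1) (j + 1) = expo p k i j := by
  simp [expo, cyc_add_one]

theorem natCast_expo {n ℓ : ℕ} [NeZero n] {p : Fin ℓ → Fin n → ℤ}
    (hp_first : ∀ k, -1 ≤ p k 0) (hp_nonneg : ∀ k j, j ≠ 0 → 0 ≤ p k j)
    (k : Fin ℓ) (i j : Fin n) :
    (expo p k i j : ℤ) = cyc i (p k) j + if j = i then 1 else 0 := by
  rw [expo, Int.toNat_of_nonneg]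
  split_ifs with h
  · subst h
    have := hp_first k
    simp only [cyc, sub_self]
    linarith
  · rw [add_zero]
    exact hp_nonneg k (j - i) (sub_ne_zero.mpr h)

theorem expo_injective {n ℓ : ℕ} [NeZero n] {p : Fin ℓ → Fin n → ℤ}
    (hp_inj : Function.Injective p)
    (hp_first : ∀ k, -1 ≤ p k 0) (hp_nonneg : ∀ k j, j ≠ 0 → 0 ≤ p k j) (i : Fin n) :
    Function.Injective fun k => expo p k i := by
  intro k l h
  apply hp_inj
  funext j
  have h1 := natCast_expo hp_first hp_nonneg k i (j + i)
  have h2 := natCast_expo hp_first hp_nonneg l i (j + i)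
  have h3 : expo p k i (j + i) = expo p l i (j + i) := congrFun h _
  rw [h3, h2] at h1
  simpa [cyc] using h1.symm

theorem prod_pow_expo {n ℓ : ℕ} [NeZero n] {p : Fin ℓ → Fin n → ℤ}
    (hp_first : ∀ k, -1 ≤ p k 0) (hp_nonneg : ∀ k j, j ≠ 0 → 0 ≤ p k j)
    (α : Fin n → ℂˣ) (k : Fin ℓ) (i : Fin n) :
    ∏ j, (α j : ℂ) ^ expo p k i j = α i * (zpowProd α (.ofAdd (cyc i (p k))) : ℂˣ) := by
  rw [zpowProd_ofAdd]
  have : ∏ j, α j ^ expo p k i j = α i * ∏ j, α j ^ cyc i (p k) j := by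
    have h : ∀ j, α j ^ expo p k i j = α j ^ cyc i (p k) j * α j ^ (if j = i then 1 else 0 : ℤ) := by
      intro j
      rw [← zpow_natCast, natCast_expo hp_first hp_nonneg, zpow_add]
    simp_rw [h, Finset.prod_mul_distrib]
    rw [mul_comm]
    congr 1
    simp
  exact_mod_cast congrArg (Units.val) this

theorem cycMatrix_mulVec {n : ℕ} [NeZero n] (α x : Fin n → ℂ) (i : Fin n) :
    (cycMatrix α).mulVec x i = α i * x (i + 1) := by
  simp [cycMatrix, Matrix.mulVec, dotProduct]

/-- A linear combination of monomials with distinct exponents vanishes as a function only if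
its coefficients vanish. -/
theorem eq_zero_of_sum_monomial {σ ι : Type*} [Fintype σ] [Fintype ι] (e : ι → σ → ℕ)
    (he : Function.Injective e) (c : ι → ℂ) (h : ∀ x : σ → ℂ, ∑ k, c k * ∏ j, x j ^ e k j = 0) :
    ∀ k, c k = 0 := by
  classical
  intro k
  have h0 : ∑ k, MvPolynomial.monomial (Finsupp.equivFunOnFinite.symm (e k)) (c k) = 0 := by
    apply MvPolynomial.funext
    intro x
    simp only [map_sum, MvPolynomial.eval_monomial, map_zero]
    rw [← h x]
    refine Finset.sum_congr rfl fun k _ => ?_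
    rw [Finsupp.prod_fintype _ _ (by simp)]
    simp
  have h1 := congrArg (MvPolynomial.coeff (Finsupp.equivFunOnFinite.symm (e k))) h0
  simpa [MvPolynomial.coeff_sum, MvPolynomial.coeff_monomial, he.eq_iff] using h1

/-- Compare coefficients of the distinct monomials in each component of `A X(x) - X(A x)`; the
factor `α i` common to both sides cancels. -/
theorem mem_equivariantSet_iff {n ℓ : ℕ} [NeZero n] {p : Fin ℓ → Fin n → ℤ}
    (hp_inj : Function.Injective p) (hp_first : ∀ k, -1 ≤ p k 0)
    (hp_nonneg : ∀ k j, j ≠ 0 → 0 ≤ p k j) (a : Fin ℓ × Fin n → ℂ) :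
    a ∈ equivariantSet p ↔ ∃ α : Fin n → ℂˣ, ∏ i, α i = 1 ∧ ∀ k i,
      a (k, i + 1) = a (k, i) * (zpowProd α (.ofAdd (cyc i (p k))) : ℂˣ) := by
  have key : ∀ (α : Fin n → ℂˣ) (x : Fin n → ℂ) (i : Fin n),
      (cycMatrix fun i => (α i : ℂ)).mulVec (nonlinearPart p a x) i -
        nonlinearPart p a ((cycMatrix fun i => (α i : ℂ)).mulVec x) i =
      ∑ k, (α i * a (k, i + 1) - a (k, i) *
        (α i * (zpowProd α (.ofAdd (cyc i (p k))) : ℂˣ))) * ∏ j, x j ^ expo p k (i + 1) j := by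
    intro α x i
    rw [cycMatrix_mulVec, nonlinearPart, nonlinearPart, Finset.mul_sum, ← Finset.sum_sub_distrib]
    refine Finset.sum_congr rfl fun k _ => ?_
    change (α i : ℂ) * (a (k, i + 1) * ∏ j, x j ^ expo p k (i + 1) j) -
      a (k, i) * ∏ j, _ ^ expo p k i j = _
    simp_rw [cycMatrix_mulVec, mul_pow, Finset.prod_mul_distrib]
    rw [prod_pow_expo hp_first hp_nonneg]
    have : ∏ j, x (j + 1) ^ expo p k i j = ∏ j, x j ^ expo p k (i + 1) j := by
      rw [← Equiv.prod_comp (Equiv.addRight (1 : Fin n)) fun j => x j ^ expo p k (i + 1) j]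
      simp [expo_add_one]
    rw [this]
    ring
  constructor
  · rintro ⟨α, hα, h⟩
    have hne : ∀ i, α i ≠ 0 := fun i hi => by
      rw [Finset.prod_eq_zero (Finset.mem_univ i) hi] at hα
      exact zero_ne_one hα
    refine ⟨fun i => Units.mk0 (α i) (hne i), by ext; simpa using hα, fun k i => ?_⟩
    have h0 := eq_zero_of_sum_monomial _ (expo_injective hp_inj hp_first hp_nonneg (i + 1)) _
      (fun x => by
        rw [← key (fun i => Units.mk0 (α i) (hne i)) x i]
        exact sub_eq_zero.mpr (congrFun (h x) i)) k
    refine mul_left_cancel₀ (hne i) ?_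
    simp only [Units.val_mk0] at h0
    linear_combination h0
  · rintro ⟨α, hα, h⟩
    refine ⟨fun i => α i, by simpa using congrArg Units.val hα, fun x => ?_⟩
    funext i
    rw [← sub_eq_zero, key]
    refine Finset.sum_eq_zero fun k _ => ?_
    rw [h]
    ring

/-! ### Both ideals vanish on the equivariant set -/

theorem eval_mono {n ℓ : ℕ} (ν : Fin ℓ × Fin n → ℕ) (a : Fin ℓ × Fin n → ℂ) :
    MvPolynomial.aeval a (mono ν) = ∏ km, a km ^ ν km := by
  simp [mono]

theorem zpowProd_L {G : Type*} [CommGroup G] {n ℓ : ℕ} [NeZero n] (p : Fin ℓ → Fin n → ℤ)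
    (α : Fin n → G) (ν : Fin ℓ × Fin n → ℕ) :
    ∏ km : Fin ℓ × Fin n, zpowProd α (.ofAdd (cyc km.2 (p km.1))) ^ ν km =
      zpowProd α (.ofAdd (L p ν)) := by
  simp_rw [← map_pow, ← map_prod, ← ofAdd_nsmul, ← ofAdd_sum]
  congr 2
  funext j
  simp [L, Fintype.sum_prod_type, mul_comm]

/-- At an equivariant point `[ν̂]` equals `[ν]` times `α ^ L(ν)`, and a constant `L(ν)` makes this
factor one. -/
theorem sibirskyIdeal_le_vanishingIdeal {n ℓ : ℕ} [NeZero n] {p : Fin ℓ → Fin n → ℤ}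
    (hp_inj : Function.Injective p) (hp_first : ∀ k, -1 ≤ p k 0)
    (hp_nonneg : ∀ k j, j ≠ 0 → 0 ≤ p k j) :
    sibirskyIdeal p ≤ MvPolynomial.vanishingIdeal ℂ (equivariantSet p) := by
  refine Ideal.span_le.mpr ?_
  rintro _ ⟨ν, ⟨K, hK⟩, rfl⟩ a ha
  obtain ⟨α, hα, h⟩ := (mem_equivariantSet_iff hp_inj hp_first hp_nonneg a).mp ha
  rw [map_sub, eval_mono, eval_mono, sub_eq_zero]
  rw [← Equiv.prod_comp ((Equiv.refl (Fin ℓ)).prodCongr (Equiv.addRight (1 : Fin n)))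
    (fun km => a km ^ hat ν km)]
  have hz : ∏ km : Fin ℓ × Fin n, ((zpowProd α (.ofAdd (cyc km.2 (p km.1))) : ℂˣ) : ℂ) ^ ν km
      = 1 := by
    have := zpowProd_L p α ν
    rw [show L p ν = fun _ => (K : ℤ) from funext hK, zpowProd_const hα] at this
    simpa using congrArg Units.val this
  simp only [Equiv.prodCongr_apply, Prod.map, Equiv.refl_apply, Equiv.coe_addRight, hat,
    add_sub_cancel_right, h, mul_pow, Finset.prod_mul_distrib, hz, mul_one]

/-- Evaluation of `ℂ[α^±, a]` at a point. -/
def evalMixed {n ℓ : ℕ} (α : Fin n → ℂˣ) (a : Fin ℓ × Fin n → ℂ) : MixedRing n ℓ →+* ℂ :=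
  MvPolynomial.eval₂Hom
    (AddMonoidAlgebra.lift ℂ ℂ (Fin n → ℤ) ((Units.coeHom ℂ).comp (zpowProd α))).toRingHom a

theorem evalMixed_X {n ℓ : ℕ} (α : Fin n → ℂˣ) (a : Fin ℓ × Fin n → ℂ) (km : Fin ℓ × Fin n) :
    evalMixed α a (MvPolynomial.X km) = a km := by
  simp [evalMixed]

theorem evalMixed_alphaPow {n ℓ : ℕ} (α : Fin n → ℂˣ) (a : Fin ℓ × Fin n → ℂ) (q : Fin n → ℤ) :
    evalMixed α a (alphaPow ℓ q) = (zpowProd α (.ofAdd q) : ℂˣ) := by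
  simp [evalMixed, alphaPow]

theorem evalMixed_inclusion {n ℓ : ℕ} (α : Fin n → ℂˣ) (a : Fin ℓ × Fin n → ℂ)
    (f : ParamRing n ℓ) : evalMixed α a (inclusion n ℓ f) = MvPolynomial.aeval a f := by
  have : (evalMixed α a).comp (inclusion n ℓ) = (MvPolynomial.aeval a).toRingHom := by
    ext <;> simp [evalMixed, inclusion]
  exact congrArg (fun g => g f) this

theorem eliminationE_le_vanishingIdeal {n ℓ : ℕ} [NeZero n] {p : Fin ℓ → Fin n → ℤ}
    (hp_inj : Function.Injective p) (hp_first : ∀ k, -1 ≤ p k 0)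
    (hp_nonneg : ∀ k j, j ≠ 0 → 0 ≤ p k j) :
    eliminationE p ≤ MvPolynomial.vanishingIdeal ℂ (equivariantSet p) := by
  intro f hf a ha
  obtain ⟨α, hα, h⟩ := (mem_equivariantSet_iff hp_inj hp_first hp_nonneg a).mp ha
  have hle : idealE p ≤ RingHom.ker (evalMixed α a) := by
    refine Ideal.span_le.mpr ?_
    rintro _ (rfl | ⟨k, i, rfl⟩)
    · simp [evalMixed_alphaPow, zpowProd_const hα]
    · simp [evalMixed_alphaPow, evalMixed_X, h]
  rw [← evalMixed_inclusion α a f]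
  exact hle hf

/-! ### The torus and its characters -/

/-- The ratios of cyclically consecutive components, a tuple with product `1`. -/
def ratio {G : Type*} [CommGroup G] {n : ℕ} [NeZero n] : (Fin n → G) →* (Fin n → G) where
  toFun t j := t (j + 1) / t j
  map_one' := by ext; simp
  map_mul' s t := by ext; simp [mul_div_mul_comm]

/-- Using `t` as coordinate removes the constraint `∏ α = 1`; the exponents of `t` all vanish
exactly when `q` is constant. -/
theorem zpowProd_ratio {G : Type*} [CommGroup G] {n : ℕ} [NeZero n] (t : Fin n → G)
    (q : Fin n → ℤ) :
    zpowProd (ratio t) (.ofAdd q) = ∏ j, t j ^ (q (j - 1) - q j) := by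
  have h : ∏ j, t (j + 1) ^ q j = ∏ j, t j ^ q (j - 1) := by
    rw [← Equiv.prod_comp (Equiv.addRight (1 : Fin n)) fun j => t j ^ q (j - 1)]
    simp
  simp only [zpowProd_ofAdd, ratio, MonoidHom.coe_mk, OneHom.coe_mk, div_zpow, zpow_sub,
    Finset.prod_mul_distrib, Finset.prod_div_distrib, h, Finset.prod_inv_distrib]
  exact div_eq_mul_inv _ _

theorem prod_ratio {G : Type*} [CommGroup G] {n : ℕ} [NeZero n] (t : Fin n → G) :
    ∏ j, ratio t j = 1 := by
  have := zpowProd_ratio t fun _ => 1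
  simpa [zpowProd_ofAdd] using this

/-- A point of the torus whose image in parameter space satisfies the equivariance relations. -/
def torusPoint {n ℓ : ℕ} [NeZero n] (p : Fin ℓ → Fin n → ℤ)
    (g : (Fin ℓ → ℂˣ) × (Fin n → ℂˣ)) (km : Fin ℓ × Fin n) : ℂˣ :=
  g.1 km.1 * zpowProd (ratio g.2) (.ofAdd (partialShift (p km.1) km.2.val))

theorem zpowProd_mul_left {G : Type*} [CommGroup G] {n : ℕ} (α β : Fin n → G)
    (q : Multiplicative (Fin n → ℤ)) : zpowProd (α * β) q = zpowProd α q * zpowProd β q := by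
  simp [zpowProd, mul_zpow, Finset.prod_mul_distrib]

theorem zpowProd_one_left {G : Type*} [CommGroup G] {n : ℕ}
    (q : Multiplicative (Fin n → ℤ)) : zpowProd (1 : Fin n → G) q = 1 := by
  simp [zpowProd]

/-- The character of the torus defined by the monomial `[ν]`. -/
def torusChar {n ℓ : ℕ} [NeZero n] (p : Fin ℓ → Fin n → ℤ) (ν : Fin ℓ × Fin n → ℕ) :
    (Fin ℓ → ℂˣ) × (Fin n → ℂˣ) →* ℂ :=
  (Units.coeHom ℂ).comp
    { toFun := fun g => ∏ km, torusPoint p g km ^ ν km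
      map_one' := by simp [torusPoint, zpowProd_one_left]
      map_mul' := fun g h => by
        rw [← Finset.prod_mul_distrib]
        refine Finset.prod_congr rfl fun km _ => ?_
        rw [← mul_pow]
        simp only [torusPoint, Prod.fst_mul, Prod.snd_mul, Pi.mul_apply, map_mul,
          zpowProd_mul_left]
        rw [mul_mul_mul_comm] }

theorem torusChar_apply {n ℓ : ℕ} [NeZero n] (p : Fin ℓ → Fin n → ℤ) (ν : Fin ℓ × Fin n → ℕ)
    (g : (Fin ℓ → ℂˣ) × (Fin n → ℂˣ)) :
    torusChar p ν g = MvPolynomial.aeval (fun km => (torusPoint p g km : ℂ)) (mono ν) := by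
  rw [eval_mono]
  simp [torusChar]

theorem torusPoint_mem_equivariantSet {n ℓ : ℕ} [NeZero n] {p : Fin ℓ → Fin n → ℤ}
    (hp_inj : Function.Injective p) (hp_first : ∀ k, -1 ≤ p k 0)
    (hp_nonneg : ∀ k j, j ≠ 0 → 0 ≤ p k j) (g : (Fin ℓ → ℂˣ) × (Fin n → ℂˣ)) :
    (fun km => (torusPoint p g km : ℂ)) ∈ equivariantSet p := by
  refine (mem_equivariantSet_iff hp_inj hp_first hp_nonneg _).mpr
    ⟨ratio g.2, prod_ratio g.2, fun k i => ?_⟩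
  rw [← Units.val_mul, torusPoint, torusPoint, mul_assoc, ← map_mul, ← ofAdd_add]
  obtain ⟨c, hc⟩ := partialShift_add_cyc (p k) i
  rw [hc, ofAdd_add, map_mul, zpowProd_const (prod_ratio g.2), mul_one]

/-- The exponent of `α` in the monomial `[ν]` on the torus. -/
def shiftSum {n ℓ : ℕ} [NeZero n] (p : Fin ℓ → Fin n → ℤ) (ν : Fin ℓ × Fin n → ℕ) : Fin n → ℤ :=
  ∑ km, ν km • partialShift (p km.1) km.2.val

theorem prod_mul_hom_pow {M : Type*} [CommMonoid M] {n ℓ : ℕ} [NeZero n] (p : Fin ℓ → Fin n → ℤ)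
    (ν : Fin ℓ × Fin n → ℕ) (b : Fin ℓ → M) (χ : Multiplicative (Fin n → ℤ) →* M) :
    ∏ km : Fin ℓ × Fin n, (b km.1 * χ (.ofAdd (partialShift (p km.1) km.2.val))) ^ ν km =
      (∏ k, b k ^ ∑ i, ν (k, i)) * χ (.ofAdd (shiftSum p ν)) := by
  simp_rw [mul_pow, Finset.prod_mul_distrib, shiftSum, ofAdd_sum, map_prod, ofAdd_nsmul, map_pow,
    Fintype.prod_prod_type, Finset.prod_pow_eq_pow_sum]

/-- The relation between exponents of monomials that agree on the torus. -/
def SameWeight {n ℓ : ℕ} [NeZero n] (p : Fin ℓ → Fin n → ℤ) (ν μ : Fin ℓ × Fin n → ℕ) : Prop :=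
  (∀ k, ∑ i, ν (k, i) = ∑ i, μ (k, i)) ∧
    ∃ c : ℤ, shiftSum p ν = shiftSum p μ + fun _ => c

theorem exists_eq_const_of_sub_one {n : ℕ} [NeZero n] (d : Fin n → ℤ)
    (h : ∀ i, d (i - 1) = d i) : ∃ c : ℤ, d = fun _ => c := by
  refine ⟨d 0, funext fun i => ?_⟩
  have : ∀ m : ℕ, d (Fin.ofNat n m) = d 0 := by
    intro m
    induction m with
    | zero => rfl
    | succ m ih =>
      rw [← ih, ← h (Fin.ofNat n (m + 1))]
      congr 1
      rw [sub_eq_iff_eq_add]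
      ext
      simp [Fin.val_add]
  simpa using this i.val

theorem prod_mulSingle_zpow {G ι : Type*} [CommGroup G] [Fintype ι] [DecidableEq ι] (i : ι) (x : G)
    (e : ι → ℤ) : ∏ j, (Pi.mulSingle i x : ι → G) j ^ e j = x ^ e i := by
  rw [Finset.prod_eq_single i (fun j _ hj => by simp [hj]) (by simp), Pi.mulSingle_eq_same]

theorem sameWeight_of_torusChar_eq {n ℓ : ℕ} [NeZero n] {p : Fin ℓ → Fin n → ℤ}
    {ν μ : Fin ℓ × Fin n → ℕ} (h : torusChar p ν = torusChar p μ) : SameWeight p ν μ := by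
  -- Since `2` is not a root of unity, setting one torus coordinate to `2` and the others to `1`
  -- reads off its exponent.
  have hinj : Function.Injective fun m : ℤ => (Units.mk0 (2 : ℂ) two_ne_zero : ℂˣ) ^ m := by
    intro a b hab
    have h1 : (2 : ℂ) ^ a = 2 ^ b := by simpa using congrArg Units.val hab
    have h2 : (2 : ℝ) ^ a = 2 ^ b := by simpa using congrArg norm h1
    exact zpow_right_injective₀ (by norm_num) (by norm_num) h2
  have key : ∀ (b : Fin ℓ → ℂˣ) (t : Fin n → ℂˣ),
      (∏ k, b k ^ ∑ i, ν (k, i)) * zpowProd (ratio t) (.ofAdd (shiftSum p ν)) =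
      (∏ k, b k ^ ∑ i, μ (k, i)) * zpowProd (ratio t) (.ofAdd (shiftSum p μ)) := by
    intro b t
    rw [← prod_mul_hom_pow, ← prod_mul_hom_pow]
    exact Units.ext (DFunLike.congr_fun h (b, t))
  refine ⟨fun k => ?_, ?_⟩
  · have := key (Pi.mulSingle k (Units.mk0 2 two_ne_zero)) 1
    simp only [map_one, zpowProd_one_left, mul_one, Pi.mulSingle_apply, ite_pow, one_pow,
      Finset.prod_ite_eq', Finset.mem_univ, if_true] at this
    have := @hinj (∑ i, ν (k, i) : ℕ) (∑ i, μ (k, i) : ℕ) (by simpa only [zpow_natCast] using this)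
    exact_mod_cast this
  · obtain ⟨c, hc⟩ := exists_eq_const_of_sub_one (shiftSum p ν - shiftSum p μ) fun i => by
      have := key 1 (Pi.mulSingle i (Units.mk0 2 two_ne_zero))
      simp only [Pi.one_apply, one_pow, Finset.prod_const_one, one_mul, zpowProd_ratio,
        prod_mulSingle_zpow] at this
      have := hinj this
      simp only [Pi.sub_apply]
      linarith
    exact ⟨c, by rw [← hc]; abel⟩

/-- A polynomial vanishing on the torus lies in every ideal containing the differences of
monomials of equal weight. -/
theorem mem_of_vanishing {n ℓ : ℕ} [NeZero n] {p : Fin ℓ → Fin n → ℤ}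
    {J : Ideal (ParamRing n ℓ)} (hJ : ∀ ν μ, SameWeight p ν μ → mono ν - mono μ ∈ J)
    {f : ParamRing n ℓ}
    (hf : ∀ g, MvPolynomial.aeval (fun km => (torusPoint p g km : ℂ)) f = 0) : f ∈ J := by
  classical
  let φ : (Fin ℓ × Fin n →₀ ℕ) → ((Fin ℓ → ℂˣ) × (Fin n → ℂˣ) →* ℂ) := fun ν => torusChar p ν
  let m : (Fin ℓ × Fin n →₀ ℕ) → ParamRing n ℓ ⧸ J := fun ν => Ideal.Quotient.mk J (mono ν)
  let F := (MvPolynomial.basisMonomials (Fin ℓ × Fin n) ℂ).repr f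
  have hmono : ∀ ν : Fin ℓ × Fin n →₀ ℕ,
      MvPolynomial.basisMonomials (Fin ℓ × Fin n) ℂ ν = mono ν := fun ν => by
    rw [MvPolynomial.coe_basisMonomials]
    dsimp only
    rw [MvPolynomial.monomial_eq,
      Finsupp.prod_fintype _ _ (by simp), mono]
    simp
  have hfF : f = Finsupp.linearCombination ℂ (fun ν : Fin ℓ × Fin n →₀ ℕ => mono ν) F := by
    rw [← funext hmono, Module.Basis.linearCombination_repr]
  -- Different monomials may give the same character, so coefficients are first collected over the
  -- fibres of `φ`; independence kills each sum.
  have h0 : Finsupp.mapDomain φ F = 0 := by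
    refine (linearIndependent_iff.mp (linearIndependent_monoidHom _ ℂ)) _ ?_
    rw [Finsupp.linearCombination_mapDomain]
    funext g
    have := hf g
    rw [hfF, Finsupp.linearCombination_apply, Finsupp.sum, map_sum] at this
    rw [Finsupp.linearCombination_apply, Finsupp.sum, Finset.sum_apply]
    simpa [φ, torusChar_apply] using this
  -- Classes modulo `J` are constant on the fibres of `φ`; the default `0` is only taken off its
  -- range.
  have hm : m = Function.extend φ m 0 ∘ φ := by
    funext ν
    have hex : ∃ μ, φ μ = φ ν := ⟨ν, rfl⟩
    rw [Function.comp_apply, Function.extend_def, dif_pos hex]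
    exact Ideal.Quotient.eq.mpr (hJ _ _ (sameWeight_of_torusChar_eq hex.choose_spec.symm))
  rw [← Ideal.Quotient.eq_zero_iff_mem]
  have : Ideal.Quotient.mk J f = Finsupp.linearCombination ℂ m F := by
    rw [hfF, ← Ideal.Quotient.mkₐ_eq_mk ℂ, ← AlgHom.coe_toLinearMap,
      Finsupp.apply_linearCombination]
    rfl
  rw [this, hm, ← Finsupp.linearCombination_mapDomain, h0, map_zero]

/-! ### Binomials in the elimination ideal -/

/-- `alphaPow` as a monoid homomorphism. -/
def alphaHom (n ℓ : ℕ) : Multiplicative (Fin n → ℤ) →* MixedRing n ℓ where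
  toFun q := alphaPow ℓ q.toAdd
  map_one' := by simp [alphaPow, ← AddMonoidAlgebra.one_def]
  map_mul' q r := by simp [alphaPow, ← map_mul, AddMonoidAlgebra.single_mul_single]

/-- Modulo `idealE p` the variables satisfy the formula defining `torusPoint`, so equal weights give
equal classes. -/
theorem sub_mem_eliminationE {n ℓ : ℕ} [NeZero n] {p : Fin ℓ → Fin n → ℤ}
    {ν μ : Fin ℓ × Fin n → ℕ} (h : SameWeight p ν μ) : mono ν - mono μ ∈ eliminationE p := by
  let q := Ideal.Quotient.mk (idealE p)
  let χ : Multiplicative (Fin n → ℤ) →* MixedRing n ℓ ⧸ idealE p :=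
    (q : MixedRing n ℓ →* MixedRing n ℓ ⧸ idealE p).comp (alphaHom n ℓ)
  have hstep : ∀ k i, q (MvPolynomial.X (k, i + 1)) =
      q (MvPolynomial.X (k, i)) * χ (.ofAdd (cyc i (p k))) := fun k i => by
    have : q (MvPolynomial.X (k, i) * alphaPow ℓ (cyc i (p k))) = q (MvPolynomial.X (k, i + 1)) :=
      Ideal.Quotient.eq.mpr (Ideal.subset_span (Or.inr ⟨k, i, rfl⟩))
    rw [← this, map_mul]
    rfl
  have hone : Multiplicative.ofAdd (fun _ => 1) ∈ χ.ker := by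
    have : q 1 = q (alphaPow ℓ fun _ => 1) :=
      Ideal.Quotient.eq.mpr (Ideal.subset_span (Or.inl rfl))
    rw [MonoidHom.mem_ker]
    exact this.symm.trans (map_one q)
  have hconst : ∀ c : ℤ, χ (.ofAdd fun _ => c) = 1 := fun c => by
    have := Subgroup.zpow_mem _ hone c
    rw [← ofAdd_zsmul, MonoidHom.mem_ker] at this
    rw [← this]
    congr 2
    funext
    simp
  have hX : ∀ k (m : ℕ), q (MvPolynomial.X (k, Fin.ofNat n m)) =
      q (MvPolynomial.X (k, 0)) * χ (.ofAdd (partialShift (p k) m)) := by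
    intro k m
    induction m with
    | zero => simp [partialShift_zero]
    | succ m ih =>
      have : Fin.ofNat n (m + 1) = Fin.ofNat n m + 1 := by ext; simp [Fin.val_add]
      rw [this, hstep, ih, partialShift_succ, ofAdd_add, map_mul, mul_assoc]
  have hm : ∀ ν, q (inclusion n ℓ (mono ν)) =
      (∏ k, q (MvPolynomial.X (k, 0)) ^ ∑ i, ν (k, i)) * χ (.ofAdd (shiftSum p ν)) := by
    intro ν
    rw [← prod_mul_hom_pow]
    simp only [mono, inclusion, map_prod, map_pow, MvPolynomial.map_X]
    refine Finset.prod_congr rfl fun km _ => ?_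
    rw [← hX, Fin.ofNat_val_eq_self]
  obtain ⟨hb, c, hc⟩ := h
  rw [eliminationE, Ideal.mem_comap, map_sub]
  refine Ideal.Quotient.eq.mp ?_
  change q _ = q _
  rw [hm, hm, hc, ofAdd_add, map_mul, hconst, mul_one]
  simp_rw [hb]

/-! ### Binomials in the saturation -/

theorem mono_add {n ℓ : ℕ} (ν μ : Fin ℓ × Fin n → ℕ) : mono (ν + μ) = mono ν * mono μ := by
  simp [mono, pow_add, Finset.prod_mul_distrib]

theorem mono_dvd_paramProd_pow {n ℓ : ℕ} (ν : Fin ℓ × Fin n → ℕ) :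
    ∃ m : ℕ, mono ν ∣ paramProd n ℓ ^ m := by
  refine ⟨∑ km, ν km, ?_⟩
  rw [paramProd, ← Finset.prod_pow]
  exact Finset.prod_dvd_prod_of_dvd _ _ fun km hkm =>
    pow_dvd_pow _ (Finset.single_le_sum (f := ν) (fun _ _ => Nat.zero_le _) hkm)

theorem sum_L {n ℓ : ℕ} [NeZero n] (p : Fin ℓ → Fin n → ℤ) (ν : Fin ℓ × Fin n → ℕ) :
    ∑ j, L p ν j = ∑ k, ∑ m, (∑ j, p k j) * (ν (k, m) : ℤ) := by
  simp only [L]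
  rw [Finset.sum_comm]
  refine Finset.sum_congr rfl fun k _ => ?_
  rw [Finset.sum_comm]
  refine Finset.sum_congr rfl fun m _ => ?_
  rw [← Finset.sum_mul, sum_cyc]

/-- Summing the coordinates gives `n * c` as a nonnegative combination of the positive sums of the
`p k`, so `c` is nonnegative. -/
theorem mem_monoidM_of_const {n ℓ : ℕ} [NeZero n] {p : Fin ℓ → Fin n → ℤ}
    (hp_sum : ∀ k, 1 ≤ ∑ j, p k j) {ν : Fin ℓ × Fin n → ℕ} {c : ℤ} (h : ∀ j, L p ν j = c) :
    ν ∈ monoidM p := by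
  have hsum := sum_L p ν
  simp only [h, Finset.sum_const, Finset.card_univ, Fintype.card_fin, nsmul_eq_mul] at hsum
  have h0 : 0 ≤ (n : ℤ) * c := by
    rw [hsum]
    exact Finset.sum_nonneg fun k _ => Finset.sum_nonneg fun m _ =>
      mul_nonneg (by linarith [hp_sum k]) (by positivity)
  have hc : 0 ≤ c := nonneg_of_mul_nonneg_right h0 (by exact_mod_cast NeZero.pos n)
  exact ⟨c.toNat, fun j => by rw [h, Int.toNat_of_nonneg hc]⟩

/-- A tuple with sum zero is a cyclic difference. -/
theorem exists_cyclic_antidifference {n : ℕ} [NeZero n] (w : Fin n → ℤ) (hw : ∑ i, w i = 0) :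
    ∃ v : Fin n → ℤ, ∀ i, w i = v (i - 1) - v i := by
  refine ⟨fun i => -∑ m ∈ Finset.range (i.val + 1), w (Fin.ofNat n m), fun i => ?_⟩
  obtain ⟨i, rfl⟩ : ∃ j, i = j + 1 := ⟨i - 1, by simp⟩
  rw [add_sub_cancel_right]
  dsimp only
  rcases val_add_one_cases i with h | ⟨h, h'⟩
  · rw [h, Finset.sum_range_succ _ (i.val + 1), ← h, Fin.ofNat_val_eq_self]
    ring
  · rw [h, h', Finset.sum_range]
    simp only [Fin.ofNat_val_eq_self, hw]
    have : i + 1 = Fin.ofNat n 0 := by ext; simp [h]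
    simp [this]

/-- In each block `ν - μ` has sum zero, hence is a cyclic difference `û - u`; the condition on
`shiftSum` then makes `L p u` constant. -/
theorem exists_mem_monoidM {n ℓ : ℕ} [NeZero n] {p : Fin ℓ → Fin n → ℤ}
    (hp_sum : ∀ k, 1 ≤ ∑ j, p k j) {ν μ : Fin ℓ × Fin n → ℕ} (h : SameWeight p ν μ) :
    ∃ u ∈ monoidM p, ν + u = μ + hat u := by
  obtain ⟨hb, c, hc⟩ := h
  have hex : ∀ k, ∃ v : Fin n → ℤ, ∀ i, (ν (k, i) : ℤ) - μ (k, i) = v (i - 1) - v i := fun k =>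
    exists_cyclic_antidifference _ (by
      rw [Finset.sum_sub_distrib, sub_eq_zero]
      exact_mod_cast hb k)
  choose v hv using hex
  -- Adding a constant leaves differences unchanged, and this one makes all entries nonnegative.
  let N : ℤ := ∑ k, ∑ i, |v k i|
  have hN : ∀ k i, 0 ≤ v k i + N := fun k i => by
    have h1 : |v k i| ≤ ∑ i, |v k i| :=
      Finset.single_le_sum (f := fun i => |v k i|) (fun _ _ => abs_nonneg _) (Finset.mem_univ i)
    have h2 : ∑ i, |v k i| ≤ N :=
      Finset.single_le_sum (f := fun k => ∑ i, |v k i|)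
        (fun _ _ => Finset.sum_nonneg fun _ _ => abs_nonneg _) (Finset.mem_univ k)
    linarith [neg_abs_le (v k i)]
  let u : Fin ℓ × Fin n → ℕ := fun km => (v km.1 km.2 + N).toNat
  have hu : ∀ k i, (u (k, i) : ℤ) = v k i + N := fun k i => Int.toNat_of_nonneg (hN k i)
  have hdiff : ∀ k i, (ν (k, i) : ℤ) - μ (k, i) = u (k, i - 1) - u (k, i) := fun k i => by
    rw [hu, hu, hv]
    ring
  refine ⟨u, ?_, ?_⟩
  -- Summation by parts: `cyc` is the difference of `partialShift` up to the constants `d`, and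
  -- moving the difference onto `u` gives `ν - μ`.
  · choose d hd using fun k => partialShift_add_cyc (p k)
    refine mem_monoidM_of_const hp_sum (c := c + ∑ k, ∑ m, d k m * u (k, m)) fun j => ?_
    have hcj : ∑ k, ∑ m : Fin n, partialShift (p k) m.val j * ((ν (k, m) : ℤ) - μ (k, m)) = c := by
      have := congrFun hc j
      simp only [shiftSum, Finset.sum_apply, Pi.add_apply, nsmul_eq_mul, Pi.mul_apply, Pi.natCast_apply,
        Fintype.sum_prod_type] at this
      simp only [mul_sub, Finset.sum_sub_distrib]
      simp only [mul_comm (partialShift _ _ _)]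
      linarith
    rw [← hcj, L, ← Finset.sum_add_distrib]
    refine Finset.sum_congr rfl fun k _ => ?_
    have hshift : ∑ m : Fin n, partialShift (p k) (m + 1).val j * (u (k, m) : ℤ) =
        ∑ m : Fin n, partialShift (p k) m.val j * (u (k, m - 1) : ℤ) := by
      rw [← Equiv.sum_comp (Equiv.addRight (1 : Fin n))
        fun m => partialShift (p k) m.val j * (u (k, m - 1) : ℤ)]
      simp
    have hcyc : ∀ m, cyc m (p k) j =
        partialShift (p k) (m + 1).val j + d k m - partialShift (p k) m.val j := fun m => by
      have := congrFun (hd k m) j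
      simp only [Pi.add_apply] at this
      linarith
    simp only [hcyc, hdiff, mul_sub, sub_mul, add_mul, Finset.sum_add_distrib,
      Finset.sum_sub_distrib, hshift]
    ring
  · funext ⟨k, i⟩
    have := hdiff k i
    simp only [Pi.add_apply, hat]
    omega

/-- From `[ν][u] = [μ][û]` follows `[û]([ν] - [μ]) = -[ν]([u] - [û])`, and `[û]` divides a power of
the product of all parameters. -/
theorem sub_mem_saturation {n ℓ : ℕ} [NeZero n] {p : Fin ℓ → Fin n → ℤ}
    (hp_sum : ∀ k, 1 ≤ ∑ j, p k j) {ν μ : Fin ℓ × Fin n → ℕ} (h : SameWeight p ν μ) :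
    mono ν - mono μ ∈ saturation (sibirskyIdeal p) (paramProd n ℓ) := by
  obtain ⟨u, hu, he⟩ := exists_mem_monoidM hp_sum h
  obtain ⟨m, r, hr⟩ := mono_dvd_paramProd_pow (hat u)
  have he' : mono ν * mono u = mono μ * mono (hat u) := by rw [← mono_add, ← mono_add, he]
  refine ⟨m, ?_⟩
  have : paramProd n ℓ ^ m * (mono ν - mono μ) = -(r * mono ν) * (mono u - mono (hat u)) := by
    rw [hr]
    linear_combination r * he'
  rw [this]
  exact Ideal.mul_mem_left _ _ (Ideal.subset_span ⟨u, hu, rfl⟩)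

end

end Sibirsky

theorem mainTheorem2 (n ℓ : ℕ) [NeZero n] (hn : n.Prime) (hn2 : 2 < n)
    (p : Fin ℓ → Fin n → ℤ) (hp_inj : Function.Injective p)
    (hp_first : ∀ k, -1 ≤ p k 0)
    (hp_nonneg : ∀ k j, j ≠ 0 → 0 ≤ p k j)
    (hp_sum : ∀ k, 1 ≤ ∑ j, p k j) :
    Sibirsky.saturation (Sibirsky.sibirskyIdeal p) (Sibirsky.paramProd n ℓ) =
        Sibirsky.eliminationE p ∧
      MvPolynomial.zeroLocus ℂ (Sibirsky.eliminationE p) =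
        Sibirsky.zariskiClosure (Sibirsky.equivariantSet p) := by
  open Sibirsky in
  have hmem := torusPoint_mem_equivariantSet hp_inj hp_first hp_nonneg
  have hE := eliminationE_le_vanishingIdeal hp_inj hp_first hp_nonneg
  have hE' : MvPolynomial.vanishingIdeal ℂ (equivariantSet p) ≤ eliminationE p := fun f hf =>
    mem_of_vanishing (fun _ _ => sub_mem_eliminationE) fun g => hf _ (hmem g)
  refine ⟨le_antisymm ?_ fun f hf => ?_, ?_⟩
  · rintro f ⟨m, hm⟩
    refine mem_of_vanishing (fun _ _ => sub_mem_eliminationE) fun g => ?_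
    have h := sibirskyIdeal_le_vanishingIdeal hp_inj hp_first hp_nonneg hm _ (hmem g)
    rw [map_mul, map_pow] at h
    refine (mul_eq_zero.mp h).resolve_left (pow_ne_zero _ ?_)
    simp [paramProd, Finset.prod_eq_zero_iff]
  · exact mem_of_vanishing (fun _ _ => sub_mem_saturation hp_sum) fun g => hE hf _ (hmem g)
  · rw [zariskiClosure, le_antisymm hE hE']
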